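/- For $\vec z=(z_1,\ldots,z_k)\in\mathbb R^k$ put $$\Pi(\vec z)=\prod_{1\le i\le k}|z_i|^{1/k},\qquad \Pi'(\vec z)=\prod_{1\le i\le k}\max(1,|z_i|)^{1/k}.$$ Let $n,m$ be positive integers. A matrix $\Theta\in\mathbb R^{n\times m}$ is called multiplicatively badly approximable if there is a constant $c>0$, depending only on $\Theta$, such that for each pair $(\vec x,\vec y)\in\mathbb Z^m\oplus\mathbb Z^n$ with $\vec x\ne\vec 0$ we have $$\Pi'(\vec x)^m\,\Pi(\Theta\vec x-\vec y)^n\ge c.$$ Theorem. A matrix $\Theta\in\mathbb R^{n\times m}$ is multiplicatively badly approximable if and only if its transpose $\Theta^{\top}\in\mathbb R^{m\times n}$ is. -/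

import Mathlib

open scoped Matrix

/-- The geometric mean `Π(z) = ∏ |z_i|^{1/k}` of the absolute values of the coordinates
of `z ∈ ℝ^k`. -/
noncomputable def geomMeanAbs {k : ℕ} (z : Fin k → ℝ) : ℝ :=
  ∏ i, |z i| ^ (1 / (k : ℝ))

/-- The truncated geometric mean `Π'(z) = ∏ max(1, |z_i|)^{1/k}` of `z ∈ ℝ^k`. -/
noncomputable def truncGeomMeanAbs {k : ℕ} (z : Fin k → ℝ) : ℝ :=
  ∏ i, (max 1 |z i|) ^ (1 / (k : ℝ))

/-- An `n × m` real matrix `Θ` is multiplicatively badly approximable if there is `c > 0` with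
`Π'(x)^m Π(Θ x - y)^n ≥ c` for all `x ∈ ℤ^m`, `y ∈ ℤ^n` with `x ≠ 0`. -/
def IsMultBadlyApproximable {n m : ℕ} (Θ : Matrix (Fin n) (Fin m) ℝ) : Prop :=
  ∃ c : ℝ, 0 < c ∧ ∀ (x : Fin m → ℤ) (y : Fin n → ℤ), x ≠ 0 →
    truncGeomMeanAbs (fun j => (x j : ℝ)) ^ m *
      geomMeanAbs (Θ *ᵥ (fun j => (x j : ℝ)) - (fun i => (y i : ℝ))) ^ n ≥ c

/-!
# Transference for multiplicatively badly approximable matrices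

After clearing roots, `Θ` is multiplicatively badly approximable iff
`∏ max(1, |x_j|) * ∏ |(Θ x - y)_i|` is bounded below over integer points with `x ≠ 0`
(`isMultBadlyApproximable_iff`). Since `Θᵀᵀ = Θ`, it suffices to turn a solution `(u, v)` that makes
this product very small for `Θᵀ` into a solution `(x, y)` that makes it small for `Θ`.

The link is the integer-valued pairing
`u ⬝ y - v ⬝ x = u ⬝ (y - Θ x) + (Θᵀ u - v) ⬝ x`.
Put `X_i = max(1, |u_i|)` and let `Y_j > 0` be slightly larger than `|(Θᵀ u - v)_j|`. Choose `i₀` with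
`u_{i₀} ≠ 0`, so that `X_{i₀} = |u_{i₀}|`. Minkowski's theorem on linear forms
(`exists_int_ne_zero_forall_abs_mulVec_lt`) is applied to the forms `x_j`, `(y - Θ x)_i` for
`i ≠ i₀`, and the pairing itself, with the bounds `max(1, t / Y_j)`, `t / X_i` and `1`; this system has
determinant `u_{i₀}` (`det_pairingMatrix`). The pairing then vanishes, being an integer less than `1`
in absolute value, and solving it for the missing form bounds `|(y - Θ x)_{i₀}|` by
`(n + m) t / X_{i₀}` (`exists_dual_int_point`).

The product attained by `(x, y)` is at most `(n + m) t` times the ratio `f(t)` of the product of the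
bounds to the determinant. So `t` should be small with `f(t)` just above the threshold `1` required by
Minkowski's theorem. The function `f` is continuous with `f(0) ≤ 1`, and
`f(t) ≥ t ^ (n - 1 + m) / (∏ X_i * ∏ Y_j)`; hence the intermediate value theorem gives `f(t) = 2` for
some `t` that is small as soon as `∏ X_i * ∏ Y_j` is (`exists_scale`). The truncation in
`max(1, t / Y_j)` is what makes the argument multiplicative: where it is active it forces `x_j = 0`,
so that this coordinate costs only a factor `1` in the product and nothing in the pairing.
-/

/-! ### Clearing roots -/

lemma geomMeanAbs_pow {k : ℕ} (z : Fin k → ℝ) : geomMeanAbs z ^ k = ∏ i, |z i| := by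
  unfold geomMeanAbs
  rw [← Finset.prod_pow]
  refine Finset.prod_congr rfl fun i _ => ?_
  rw [one_div, Real.rpow_inv_natCast_pow (abs_nonneg _) (Fin.pos i).ne']

lemma truncGeomMeanAbs_pow {k : ℕ} (z : Fin k → ℝ) :
    truncGeomMeanAbs z ^ k = ∏ i, max 1 |z i| := by
  unfold truncGeomMeanAbs
  rw [← Finset.prod_pow]
  refine Finset.prod_congr rfl fun i _ => ?_
  rw [one_div, Real.rpow_inv_natCast_pow (by positivity) (Fin.pos i).ne']

lemma isMultBadlyApproximable_iff {n m : ℕ} (Θ : Matrix (Fin n) (Fin m) ℝ) :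
    IsMultBadlyApproximable Θ ↔ ∃ c : ℝ, 0 < c ∧ ∀ (x : Fin m → ℤ) (y : Fin n → ℤ), x ≠ 0 →
      c ≤ (∏ j, max 1 |(x j : ℝ)|) * ∏ i, |(Θ *ᵥ fun j => (x j : ℝ)) i - y i| := by
  simp only [IsMultBadlyApproximable, truncGeomMeanAbs_pow, geomMeanAbs_pow, ge_iff_le,
    Pi.sub_apply]

/-! ### Minkowski's theorem on linear forms -/

open MeasureTheory in
/-- Minkowski's theorem on linear forms, in the version with all inequalities strict. -/
lemma exists_int_ne_zero_forall_abs_mulVec_lt {ι : Type*} [Fintype ι] [DecidableEq ι]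
    (A : Matrix ι ι ℝ) (hA : A.det ≠ 0) (b : ι → ℝ) (hb : ∀ i, 0 < b i)
    (h : |A.det| < ∏ i, b i) :
    ∃ z : ι → ℤ, z ≠ 0 ∧ ∀ i, |(A *ᵥ fun k => (z k : ℝ)) i| < b i := by
  set B : Set (ι → ℝ) := Set.univ.pi fun i => Set.Ioo (-b i) (b i) with hB
  set S : Set (ι → ℝ) := Matrix.toLin' A ⁻¹' B with hS
  have hmem : ∀ z, z ∈ S ↔ ∀ i, |(A *ᵥ z) i| < b i := by
    intro z
    simp [hS, hB, abs_lt, Set.mem_pi]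
  have hconv : Convex ℝ S :=
    (convex_pi fun i _ => convex_Ioo _ _).linear_preimage (Matrix.toLin' A)
  have hsymm : ∀ z ∈ S, -z ∈ S := by
    intro z hz
    rw [hmem] at hz ⊢
    intro i
    simpa [Matrix.mulVec_neg] using hz i
  have hdet : LinearMap.det (Matrix.toLin' A) = A.det := LinearMap.det_toLin' A
  have hvol : volume S = ENNReal.ofReal (|A.det|⁻¹ * ∏ i, (2 * b i)) := by
    rw [hS, Measure.addHaar_preimage_linearMap volume (by rwa [hdet]), hdet, hB,
      Real.volume_pi_Ioo, abs_inv, ENNReal.ofReal_mul (by positivity),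
      ENNReal.ofReal_prod_of_nonneg fun i _ => by linarith [hb i]]
    congr 2 with i
    ring_nf
  let E := Pi.basisFun ℝ ι
  have hfund := ZSpan.isAddFundamentalDomain' E volume
  have hF : volume (ZSpan.fundamentalDomain E) = 1 := by
    rw [ZSpan.fundamentalDomain_pi_basisFun, Real.volume_pi_Ico]
    simp
  have hlt : volume (ZSpan.fundamentalDomain E) * 2 ^ Module.finrank ℝ (ι → ℝ) < volume S := by
    rw [hF, one_mul, hvol, Module.finrank_fintype_fun_eq_card]
    have : (2 : ENNReal) ^ Fintype.card ι = ENNReal.ofReal (2 ^ Fintype.card ι) := by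
      rw [ENNReal.ofReal_pow (by norm_num)]; norm_num
    have hpos : 0 < |A.det| := abs_pos.mpr hA
    rw [this, Finset.prod_mul_distrib, Finset.prod_const, Finset.card_univ]
    refine (ENNReal.ofReal_lt_ofReal_iff_of_nonneg (by positivity)).mpr ?_
    rw [inv_mul_eq_div, lt_div_iff₀ hpos]
    exact mul_lt_mul_of_pos_left h (by positivity)
  have : Countable (Submodule.span ℤ (Set.range E)).toAddSubgroup :=
    inferInstanceAs (Countable (Submodule.span ℤ (Set.range E)))
  obtain ⟨p, hp0, hpS⟩ :=
    exists_ne_zero_mem_lattice_of_measure_mul_two_pow_lt_measure hfund hsymm hconv hlt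
  have hint : ∀ i, ∃ a : ℤ, (a : ℝ) = (p : ι → ℝ) i := by
    intro i
    have := (E.mem_span_iff_repr_mem ℤ (p : ι → ℝ)).mp p.2 i
    simpa [E] using this
  choose z hz using hint
  have hzp : (fun k => (z k : ℝ)) = (p : ι → ℝ) := funext hz
  refine ⟨z, ?_, ?_⟩
  · rintro rfl
    apply hp0
    ext i
    simp [← hz i]
  · rw [hzp]
    exact (hmem _).mp hpS

/-! ### The dual integer point -/

/-- The matrix, in the variables `(x, y)`, of the linear forms `x_j`, `(y - Θ x)_i` for `i ≠ i₀`, and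
`u ⬝ y - v ⬝ x` in place of the form with index `i₀`. -/
def pairingMatrix {n m : ℕ} (Θ : Matrix (Fin n) (Fin m) ℝ) (u : Fin n → ℝ) (v : Fin m → ℝ)
    (i₀ : Fin n) : Matrix (Fin m ⊕ Fin n) (Fin m ⊕ Fin n) ℝ :=
  Matrix.fromBlocks 1 0 ((-Θ).updateRow i₀ (-v)) ((1 : Matrix (Fin n) (Fin n) ℝ).updateRow i₀ u)

lemma det_pairingMatrix {n m : ℕ} (Θ : Matrix (Fin n) (Fin m) ℝ) (u : Fin n → ℝ)
    (v : Fin m → ℝ) (i₀ : Fin n) : (pairingMatrix Θ u v i₀).det = u i₀ := by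
  rw [pairingMatrix, Matrix.det_fromBlocks_zero₁₂, Matrix.det_one, one_mul]
  have h := Matrix.det_updateRow_sum (1 : Matrix (Fin n) (Fin n) ℝ) i₀ u
  have hu : (∑ k, u k • (1 : Matrix (Fin n) (Fin n) ℝ) k) = u := by
    ext l
    simp [Finset.sum_apply, Matrix.one_apply]
  rw [hu] at h
  simpa using h

/-- From an integer point `(u, v)` with `|u_i| ≤ X_i`, with equality at `i₀`, and
`|(Θᵀ u - v)_j| ≤ Y_j`, Minkowski's theorem produces an integer point `(x, y)` for `Θ`. -/
lemma exists_dual_int_point {n m : ℕ} (Θ : Matrix (Fin n) (Fin m) ℝ) (u : Fin n → ℤ)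
    (v : Fin m → ℤ) {X : Fin n → ℝ} {Y : Fin m → ℝ} (i₀ : Fin n) {t : ℝ} (ht : 0 < t)
    (hX : ∀ i, 0 < X i) (hY : ∀ j, 0 < Y j) (hu : ∀ i, |(u i : ℝ)| ≤ X i)
    (hi₀ : |(u i₀ : ℝ)| = X i₀) (hv : ∀ j, |(Θᵀ *ᵥ fun i => (u i : ℝ)) j - v j| ≤ Y j)
    (hvol : ∏ i, X i < t ^ (n - 1) * ∏ j, max 1 (t / Y j)) :
    ∃ (x : Fin m → ℤ) (y : Fin n → ℤ), (x ≠ 0 ∨ y ≠ 0) ∧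
      (∀ j, |(x j : ℝ)| < max 1 (t / Y j)) ∧
      (∀ i, i ≠ i₀ → |(Θ *ᵥ fun j => (x j : ℝ)) i - y i| ≤ t / X i) ∧
      |(Θ *ᵥ fun j => (x j : ℝ)) i₀ - y i₀| ≤ (n + m) * t / X i₀ := by
  set A := pairingMatrix Θ (fun i => (u i : ℝ)) (fun j => (v j : ℝ)) i₀ with hA
  have hdet : A.det = u i₀ := det_pairingMatrix _ _ _ _
  set b : Fin m ⊕ Fin n → ℝ :=
    Sum.elim (fun j => max 1 (t / Y j)) (Function.update (fun i => t / X i) i₀ 1)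
    with hb
  have hbl : ∀ j, b (Sum.inl j) = max 1 (t / Y j) := fun _ => rfl
  have hbr : ∀ i, i ≠ i₀ → b (Sum.inr i) = t / X i := by
    intro i hi
    rw [hb, Sum.elim_inr, Function.update_of_ne hi]
  have hb₀ : b (Sum.inr i₀) = 1 := by rw [hb, Sum.elim_inr, Function.update_self]
  have hbpos : ∀ k, 0 < b k := by
    rintro (j | i)
    · rw [hbl]; positivity
    · rcases eq_or_ne i i₀ with rfl | h
      · rw [hb₀]; exact one_pos
      · rw [hbr i h]; exact div_pos ht (hX i)
  have hprod : |A.det| < ∏ k, b k := by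
    have hXp : X i₀ * ∏ i ∈ Finset.univ.erase i₀, X i = ∏ i, X i :=
      Finset.mul_prod_erase _ _ (Finset.mem_univ _)
    have hE : 0 < ∏ i ∈ Finset.univ.erase i₀, X i := Finset.prod_pos fun i _ => hX i
    have h2 : ∏ i, Function.update (fun i => t / X i) i₀ 1 i
        = t ^ (n - 1) / ∏ i ∈ Finset.univ.erase i₀, X i := by
      rw [Finset.prod_update_of_mem (Finset.mem_univ _), one_mul, ← Finset.erase_eq,
        Finset.prod_div_distrib, Finset.prod_const, Finset.card_erase_of_mem (Finset.mem_univ _),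
        Finset.card_univ, Fintype.card_fin]
    rw [hdet, hi₀, hb, Fintype.prod_sum_type]
    simp only [Sum.elim_inl, Sum.elim_inr]
    rw [h2, ← mul_div_assoc, lt_div_iff₀ hE, hXp, mul_comm (∏ j, _)]
    exact hvol
  have hne : A.det ≠ 0 := by
    rw [hdet, ← abs_pos, hi₀]; exact hX i₀
  obtain ⟨z, hz0, hz⟩ := exists_int_ne_zero_forall_abs_mulVec_lt A hne b hbpos hprod
  set x : Fin m → ℤ := fun j => z (Sum.inl j) with hx
  set y : Fin n → ℤ := fun i => z (Sum.inr i) with hy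
  have hzx : (fun k => (z k : ℝ)) = Sum.elim (fun j => (x j : ℝ)) (fun i => (y i : ℝ)) := by
    ext (j | i) <;> rfl
  have hform : ∀ i, (A *ᵥ fun k => (z k : ℝ)) (Sum.inr i) =
      ((-Θ).updateRow i₀ (-fun j => (v j : ℝ)) *ᵥ fun j => (x j : ℝ)) i +
      ((1 : Matrix (Fin n) (Fin n) ℝ).updateRow i₀ (fun i => (u i : ℝ)) *ᵥ
        fun i => (y i : ℝ)) i := by
    intro i
    rw [hzx, hA, pairingMatrix, Matrix.fromBlocks_mulVec]
    simp
  have h1 : ∀ j, |(x j : ℝ)| < max 1 (t / Y j) := by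
    intro j
    have := hz (Sum.inl j)
    rw [hzx, hA, pairingMatrix, Matrix.fromBlocks_mulVec] at this
    simpa only [Sum.elim_comp_inl, Sum.elim_comp_inr, Sum.elim_inl, Matrix.one_mulVec,
      Matrix.zero_mulVec, add_zero, hbl] using this
  have h2 : ∀ i, i ≠ i₀ → |(Θ *ᵥ fun j => (x j : ℝ)) i - y i| ≤ t / X i := by
    intro i hi
    have := hz (Sum.inr i)
    rw [hform, hbr i hi] at this
    simp only [Function.update_of_ne hi, Matrix.updateRow_mulVec,
      Matrix.one_mulVec, Matrix.neg_mulVec, Pi.neg_apply] at this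
    rw [abs_sub_comm, sub_eq_neg_add]
    exact this.le
  -- The pairing is an integer of absolute value less than `1`.
  have h3 : ∑ i, (u i : ℝ) * y i - ∑ j, (v j : ℝ) * x j = 0 := by
    have := hz (Sum.inr i₀)
    rw [hform, hb₀] at this
    simp only [Function.update_self, Matrix.updateRow_mulVec, Matrix.one_mulVec,
      neg_dotProduct] at this
    rw [neg_add_eq_sub] at this
    simp only [dotProduct] at this
    have h4 : |∑ i, u i * y i - ∑ j, v j * x j| < 1 := by exact_mod_cast this
    exact_mod_cast Int.abs_lt_one_iff.mp h4
  have hadj : ∑ i, (u i : ℝ) * (Θ *ᵥ fun j => (x j : ℝ)) i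
      = ∑ j, (Θᵀ *ᵥ fun i => (u i : ℝ)) j * x j := by
    have := Matrix.dotProduct_mulVec (fun i => (u i : ℝ)) Θ (fun j => (x j : ℝ))
    rwa [← Matrix.mulVec_transpose] at this
  have hpair : ∑ i, (u i : ℝ) * ((Θ *ᵥ fun j => (x j : ℝ)) i - y i)
      = ∑ j, ((Θᵀ *ᵥ fun i => (u i : ℝ)) j - v j) * x j := by
    simp only [mul_sub, sub_mul, Finset.sum_sub_distrib]
    linarith
  have hxY : ∀ j, |((Θᵀ *ᵥ fun i => (u i : ℝ)) j - v j) * x j| ≤ t := by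
    intro j
    rcases le_total (t / Y j) 1 with h | h
    · -- The bound `1` on the integer `x j` forces it to vanish.
      have := h1 j
      rw [max_eq_left h] at this
      have h0 : x j = 0 := Int.abs_lt_one_iff.mp (by exact_mod_cast this)
      simp [h0, ht.le]
    · have := h1 j
      rw [max_eq_right h, lt_div_iff₀ (hY j)] at this
      rw [abs_mul]
      nlinarith [hv j, abs_nonneg (x j : ℝ)]
  have huX : ∀ i ∈ Finset.univ.erase i₀,
      |(u i : ℝ) * ((Θ *ᵥ fun j => (x j : ℝ)) i - y i)| ≤ t := by
    intro i hi
    have := h2 i (Finset.ne_of_mem_erase hi)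
    rw [le_div_iff₀ (hX i)] at this
    rw [abs_mul]
    nlinarith [hu i, abs_nonneg ((Θ *ᵥ fun j => (x j : ℝ)) i - y i)]
  refine ⟨x, y, ?_, h1, h2, ?_⟩
  · by_contra! h
    apply hz0
    ext (j | i)
    · exact congrFun h.1 j
    · exact congrFun h.2 i
  · rw [← Finset.add_sum_erase _ _ (Finset.mem_univ i₀)] at hpair
    rw [le_div_iff₀ (hX i₀), ← hi₀, mul_comm, ← abs_mul, eq_sub_of_add_eq hpair]
    refine (abs_sub _ _).trans ?_
    have e1 := (Finset.abs_sum_le_sum_abs _ _).trans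
      (Finset.sum_le_card_nsmul Finset.univ _ t fun j _ => hxY j)
    have e2 := (Finset.abs_sum_le_sum_abs _ _).trans
      (Finset.sum_le_card_nsmul _ _ t huX)
    have e3 : ((Finset.univ.erase i₀).card : ℝ) ≤ n := by
      exact_mod_cast (Finset.card_le_univ _).trans_eq (Fintype.card_fin n)
    simp only [Finset.card_univ, Fintype.card_fin, nsmul_eq_mul] at e1 e2
    nlinarith

/-! ### Choice of the parameters -/

/-- The scale at which the volume of Minkowski's system exceeds the threshold by the factor `2`. -/
lemma exists_scale {k m : ℕ} {P t₀ : ℝ} {Y : Fin m → ℝ} (hP : 1 ≤ P) (hY : ∀ j, 0 < Y j)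
    (ht₀ : 0 < t₀) (h : P * ∏ j, Y j ≤ t₀ ^ (k + m) / 2) :
    ∃ t, 0 < t ∧ t ≤ t₀ ∧ t ^ k * ∏ j, max 1 (t / Y j) = 2 * P := by
  set f : ℝ → ℝ := fun t => t ^ k * ∏ j, max 1 (t / Y j) with hf
  have hcont : Continuous f := by
    refine (continuous_pow k).mul (continuous_finsetProd _ fun j _ => ?_)
    exact continuous_const.max (continuous_id.div_const _)
  have h0 : f 0 ≤ 1 := by
    simp only [hf, zero_div]
    simpa using pow_le_one₀ (n := k) le_rfl zero_le_one
  have hYp : 0 < ∏ j, Y j := Finset.prod_pos fun j _ => hY j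
  have h1 : 2 * P ≤ f t₀ := by
    have e : ∏ j, (t₀ / Y j) ≤ ∏ j, max 1 (t₀ / Y j) :=
      Finset.prod_le_prod (fun j _ => (div_pos ht₀ (hY j)).le) fun j _ => le_max_right _ _
    rw [Finset.prod_div_distrib, Finset.prod_const, Finset.card_univ, Fintype.card_fin] at e
    calc 2 * P ≤ t₀ ^ (k + m) / ∏ j, Y j := by
          rw [le_div_iff₀ hYp]; linarith
      _ = t₀ ^ k * (t₀ ^ m / ∏ j, Y j) := by rw [pow_add, mul_div_assoc]
      _ ≤ f t₀ := mul_le_mul_of_nonneg_left e (by positivity)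
  obtain ⟨t, ⟨ht, htt⟩, hft⟩ :=
    intermediate_value_Icc ht₀.le hcont.continuousOn ⟨by linarith, h1⟩
  refine ⟨t, lt_of_le_of_ne ht ?_, htt, hft⟩
  rintro rfl
  linarith

/-- The numbers `|w_j|` can be enlarged to be positive while keeping their weighted product small. -/
lemma exists_pos_bounds {m : ℕ} {P ε : ℝ} (w : Fin m → ℝ) (h : P * ∏ j, |w j| < ε) :
    ∃ Y : Fin m → ℝ, (∀ j, 0 < Y j) ∧ (∀ j, |w j| ≤ Y j) ∧ P * ∏ j, Y j ≤ ε := by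
  have hcont : Continuous fun s : ℝ => P * ∏ j, (|w j| + s) := by fun_prop
  have hev : ∀ᶠ s in nhds (0 : ℝ), P * ∏ j, (|w j| + s) < ε :=
    hcont.continuousAt.eventually_lt_const (by simpa using h)
  obtain ⟨s, hs, hs0⟩ :=
    ((hev.filter_mono nhdsWithin_le_nhds).and (self_mem_nhdsWithin (s := Set.Ioi (0 : ℝ)))).exists
  replace hs0 : 0 < s := hs0
  exact ⟨fun j => |w j| + s, fun j => by positivity, fun j => by linarith, hs.le⟩

/-! ### The transference theorem -/

lemma IsMultBadlyApproximable.transpose {n m : ℕ} {Θ : Matrix (Fin n) (Fin m) ℝ}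
    (h : IsMultBadlyApproximable Θ) : IsMultBadlyApproximable Θᵀ := by
  rw [isMultBadlyApproximable_iff] at h ⊢
  obtain ⟨c, hc, h⟩ := h
  rcases Nat.eq_zero_or_pos n with rfl | hn
  · exact ⟨1, one_pos, fun u v hu => (hu (Subsingleton.elim _ _)).elim⟩
  set K : ℝ := n + m with hK
  have hK1 : 1 ≤ K := by
    have : (1 : ℝ) ≤ n := by exact_mod_cast hn
    have : (0 : ℝ) ≤ m := by positivity
    linarith
  -- The scale is chosen so that `K * t₀ < 1` and `2 * K * t₀ < c`.
  set t₀ : ℝ := min 1 c / (4 * K) with ht₀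
  have hKt : K * t₀ = min 1 c / 4 := by
    rw [ht₀]; field_simp
  have hm0 : 0 < min 1 c := lt_min one_pos hc
  have ht₀pos : 0 < t₀ := by positivity
  have hm1 : min 1 c ≤ 1 := min_le_left _ _
  have hmc : min 1 c ≤ c := min_le_right _ _
  refine ⟨t₀ ^ (n - 1 + m) / 2, by positivity, fun u v hu => ?_⟩
  by_contra! hlt
  set X : Fin n → ℝ := fun i => max 1 |(u i : ℝ)| with hX
  have hX1 : ∀ i, 1 ≤ X i := fun i => le_max_left _ _
  have hXpos : ∀ i, 0 < X i := fun i => one_pos.trans_le (hX1 i)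
  have hP1 : 1 ≤ ∏ i, X i := Finset.one_le_prod fun i _ => hX1 i
  obtain ⟨Y, hYpos, hY, hPY⟩ := exists_pos_bounds _ hlt
  obtain ⟨t, ht, htt, hft⟩ := exists_scale hP1 hYpos ht₀pos hPY
  obtain ⟨i₀, hi₀⟩ := Function.ne_iff.mp hu
  have hui₀ : |(u i₀ : ℝ)| = X i₀ := by
    refine (max_eq_right ?_).symm
    exact_mod_cast Int.one_le_abs hi₀
  obtain ⟨x, y, hxy, hx, hy, hy₀⟩ := exists_dual_int_point Θ u v i₀ ht hXpos hYpos
    (fun i => le_max_right _ _) hui₀ hY (by rw [hft]; linarith)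
  have hKtt : K * t ≤ K * t₀ := by gcongr
  have htK : t ≤ K * t := le_mul_of_one_le_left ht.le hK1
  have hall : ∀ i, |(Θ *ᵥ fun j => (x j : ℝ)) i - y i| ≤ K * t / X i := by
    intro i
    rcases eq_or_ne i i₀ with rfl | hi
    · exact hy₀
    · exact (hy i hi).trans (div_le_div_of_nonneg_right htK (hXpos i).le)
  have hx0 : x ≠ 0 := by
    rintro rfl
    rcases hxy with h0 | h0
    · exact h0 rfl
    · apply h0
      ext i
      have e := hall i
      have e' : K * t / X i ≤ K * t := div_le_self (by positivity) (hX1 i)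
      have : |(y i : ℝ)| < 1 := by
        have e2 : (Θ *ᵥ fun j => (((0 : Fin m → ℤ) j : ℤ) : ℝ)) i = 0 := by
          simp [Matrix.mulVec, dotProduct]
        rw [e2, zero_sub, abs_neg] at e
        linarith
      exact Int.abs_lt_one_iff.mp (by exact_mod_cast this)
  have hc' := h x y hx0
  have hb1 : ∏ j, max 1 |(x j : ℝ)| ≤ ∏ j, max 1 (t / Y j) :=
    Finset.prod_le_prod (fun j _ => by positivity) fun j _ =>
      max_le (le_max_left _ _) (hx j).le
  have hXp : X i₀ * ∏ i ∈ Finset.univ.erase i₀, X i = ∏ i, X i :=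
    Finset.mul_prod_erase _ _ (Finset.mem_univ _)
  have hb2 : ∏ i, |(Θ *ᵥ fun j => (x j : ℝ)) i - y i| ≤ K * t * t ^ (n - 1) / ∏ i, X i := by
    rw [← Finset.mul_prod_erase _ _ (Finset.mem_univ i₀), ← hXp, mul_div_mul_comm]
    refine mul_le_mul hy₀ ?_ (Finset.prod_nonneg fun i _ => abs_nonneg _)
      (div_nonneg (by positivity) (hXpos _).le)
    refine (Finset.prod_le_prod (fun i _ => abs_nonneg _)
      fun i hi => hy i (Finset.ne_of_mem_erase hi)).trans_eq ?_
    rw [Finset.prod_div_distrib, Finset.prod_const, Finset.card_erase_of_mem (Finset.mem_univ _),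
      Finset.card_univ, Fintype.card_fin]
  have hfin : c ≤ 2 * (K * t) := by
    calc c ≤ _ := hc'
      _ ≤ (∏ j, max 1 (t / Y j)) * (K * t * t ^ (n - 1) / ∏ i, X i) :=
        mul_le_mul hb1 hb2 (Finset.prod_nonneg fun i _ => abs_nonneg _)
          (Finset.prod_nonneg fun i _ => by positivity)
      _ = (t ^ (n - 1) * ∏ j, max 1 (t / Y j)) * (K * t) / ∏ i, X i := by ring
      _ = 2 * (K * t) := by
        rw [hft]
        field_simp
  linarith

theorem theoremt {n m : ℕ} (Θ : Matrix (Fin n) (Fin m) ℝ) :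
    IsMultBadlyApproximable Θ ↔ IsMultBadlyApproximable Θᵀ := by
  refine ⟨IsMultBadlyApproximable.transpose, fun h => ?_⟩
  simpa using h.transpose
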